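/- Let $k$ be a field of characteristic zero, $P_n=k[x_1,\dots,x_n]$, and let $F=(f_1,\dots,f_n)$ be an arbitrary $n$-tuple of elements of $P_n$. For an $n$-tuple $G=(g_1,\dots,g_n)$ of elements of $P_n$ let $D_G=g_1\partial_1+\dots+g_n\partial_n$ be the derivation of $P_n$ with $D_G(x_i)=g_i$, where $\partial_i=\partial/\partial x_i$. Let $\cdot$ be the (left-symmetric) bilinear product on the space of $k$-derivations of $P_n$ given by $(a\partial_i)\cdot(b\partial_j)=\bigl((a\partial_i)(b)\bigr)\partial_j$ for $a,b\in P_n$. For a derivation $D$ define its right powers by $D^{[1]}=D$ and $D^{[m+1]}=D^{[m]}\cdot D$ for $m\ge 1$. Let $L_F$ be the Lie subalgebra, generated by all right powers $D_F^{[m]}$, $m\ge 1$, of the Lie algebra of all $k$-derivations of $P_n$ (with bracket the commutator). Put $X=(x_1,\dots,x_n)$, let $t$ be an independent parameter, and let $$(X+tF)^{-1}=X+tF_1+t^2F_2+\dots+t^mF_m+\cdots$$ with $n$-tuples $F_m$ of elements of $P_n$ be the formal inverse of $X+tF$, that is, its (existing and unique) two-sided inverse with respect to composition, in the variables $x_1,\dots,x_n$,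 among $n$-tuples of power series in $t$ with coefficients in $P_n$. Then the Lie algebra $L_F$ is generated by the derivations $D_{F_m}$, $m\ge 1$. -/

import Mathlib

namespace FormalInverse

open MvPolynomial

/-- The derivation `D_F = f₁ ∂₁ + ⋯ + fₙ ∂ₙ` of `k[x₁, …, xₙ]`, i.e. the one with
`D_F (xᵢ) = fᵢ`. -/
noncomputable def derivationOf {k : Type*} [Field k] {n : ℕ}
    (F : Fin n → MvPolynomial (Fin n) k) :
    Derivation k (MvPolynomial (Fin n) k) (MvPolynomial (Fin n) k) :=
  mkDerivation k F

/-- The left-symmetric product of derivations of `k[x₁, …, xₙ]`: the bilinear operation with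
`(a ∂ᵢ) · (b ∂ⱼ) = ((a ∂ᵢ) b) ∂ⱼ`, i.e. `D · E = ∑ⱼ D (E xⱼ) ∂ⱼ`. -/
noncomputable def lsMul {k : Type*} [Field k] {n : ℕ}
    (D E : Derivation k (MvPolynomial (Fin n) k) (MvPolynomial (Fin n) k)) :
    Derivation k (MvPolynomial (Fin n) k) (MvPolynomial (Fin n) k) :=
  derivationOf fun j => D (E (X j))

/-- The right powers of a derivation: `D^[1] = D`, `D^[m+1] = D^[m] · D` for `m ≥ 1`
(with the convention `D^[0] = D`). -/
noncomputable def rightPower {k : Type*} [Field k] {n : ℕ}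
    (D : Derivation k (MvPolynomial (Fin n) k) (MvPolynomial (Fin n) k)) :
    ℕ → Derivation k (MvPolynomial (Fin n) k) (MvPolynomial (Fin n) k)
  | 0 => D
  | 1 => D
  | m + 2 => lsMul (rightPower D (m + 1)) D

/-- The Lie algebra `L_D`: the Lie subalgebra of the derivations of `k[x₁, …, xₙ]` generated by all
right powers `D^[m]`, `m ≥ 1`. -/
noncomputable def rightPowerLieAlgebra {k : Type*} [Field k] {n : ℕ}
    (D : Derivation k (MvPolynomial (Fin n) k) (MvPolynomial (Fin n) k)) :
    LieSubalgebra k (Derivation k (MvPolynomial (Fin n) k) (MvPolynomial (Fin n) k)) :=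
  LieSubalgebra.lieSpan k _ {E | ∃ m : ℕ, 1 ≤ m ∧ E = rightPower D m}

/-- The substitution `xᵢ ↦ Hᵢ` in a power series in `t` over `k[x₁, …, xₙ]`, for a tuple `H` of such
series: `∑ tⁱ aᵢ` goes to `∑ tⁱ aᵢ(H₁, …, Hₙ)`. -/
noncomputable def substX {k : Type*} [Field k] {n : ℕ}
    (H : Fin n → PowerSeries (MvPolynomial (Fin n) k))
    (p : PowerSeries (MvPolynomial (Fin n) k)) : PowerSeries (MvPolynomial (Fin n) k) :=
  PowerSeries.mk fun N => ∑ ij ∈ Finset.HasAntidiagonal.antidiagonal N,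
    PowerSeries.coeff ij.2 (aeval H (PowerSeries.coeff ij.1 p))

/-- The composition `G ∘ H` of two `n`-tuples of power series in `t` over `k[x₁, …, xₙ]`, seen as
endomorphisms in the variables `x₁, …, xₙ` with parameter `t`: `(G ∘ H)ᵢ = Gᵢ(H₁, …, Hₙ)`. -/
noncomputable def comp {k : Type*} [Field k] {n : ℕ}
    (G H : Fin n → PowerSeries (MvPolynomial (Fin n) k)) :
    Fin n → PowerSeries (MvPolynomial (Fin n) k) :=
  fun i => substX H (G i)

/-- The identity endomorphism `X = (x₁, …, xₙ)`. -/
noncomputable def idTuple (k : Type*) [Field k] (n : ℕ) :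
    Fin n → PowerSeries (MvPolynomial (Fin n) k) :=
  fun i => PowerSeries.C (X i)

/-- The endomorphism `X + tF`. -/
noncomputable def xAddT {k : Type*} [Field k] {n : ℕ} (F : Fin n → MvPolynomial (Fin n) k) :
    Fin n → PowerSeries (MvPolynomial (Fin n) k) :=
  fun i => PowerSeries.C (X i) + PowerSeries.X * PowerSeries.C (F i)

/-- `G` is the formal inverse of `X + tF`: a two-sided inverse with respect to composition. -/
def IsFormalInverse {k : Type*} [Field k] {n : ℕ} (F : Fin n → MvPolynomial (Fin n) k)
    (G : Fin n → PowerSeries (MvPolynomial (Fin n) k)) : Prop :=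
  comp (xAddT F) G = idTuple k n ∧ comp G (xAddT F) = idTuple k n

/-- The tuple `G_m` of coefficients at `t ^ m` of `G = ∑ t ^ m G_m`. -/
noncomputable def coeffTuple {k : Type*} [Field k] {n : ℕ}
    (G : Fin n → PowerSeries (MvPolynomial (Fin n) k)) (m : ℕ) : Fin n → MvPolynomial (Fin n) k :=
  fun i => PowerSeries.coeff m (G i)

end FormalInverse

/-! ### Derivatives and inverses of power series over a noncommutative ring. -/

namespace PowerSeries

/-! Let S be the substitution p ↦ p(X + tF), viewed as a power series in t whose coefficients are
linear operators on polynomials. Its constant term is 1, so it is invertible, and composing tuples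
becomes multiplying operator series in reverse order. The derivative S' in t can be written in two
ways. As S' = rS, the coefficients of r are (-1)^j D_F^[j+1]; as S' = Se, the coefficients of e are
-D_{F_{j+1}} (`tderiv_substOp_xAddT_eq_rightPower`, `tderiv_substOp_xAddT_eq_coeffTuple`).

Thus r = S e S⁻¹. In characteristic zero, conjugation by S keeps coefficients inside any
commutator-closed subspace containing those of e, and likewise for S⁻¹ and r
(`coeff_mem_iff_of_tderiv`). Hence a Lie subalgebra contains all D_F^[m] iff it contains all
D_{F_m}, and the two families generate the same algebra. -/

/-- The termwise derivative of a power series over a semiring that need not be commutative. -/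
noncomputable def tderiv {R : Type*} [Semiring R] (f : PowerSeries R) : PowerSeries R :=
  mk fun n => (n + 1) • coeff (n + 1) f

theorem coeff_tderiv {R : Type*} [Semiring R] (f : PowerSeries R) (n : ℕ) :
    coeff n (tderiv f) = (n + 1) • coeff (n + 1) f := by
  simp [tderiv]

theorem tderiv_mul {R : Type*} [Semiring R] (f g : PowerSeries R) :
    tderiv (f * g) = tderiv f * g + f * tderiv g := by
  ext n
  rw [coeff_tderiv, map_add, coeff_mul, coeff_mul, coeff_mul, Finset.smul_sum]
  have h : ∀ p ∈ Finset.HasAntidiagonal.antidiagonal (n + 1), (n + 1) • (coeff p.1 f * coeff p.2 g) =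
      (p.1 • coeff p.1 f) * coeff p.2 g + coeff p.1 f * (p.2 • coeff p.2 g) := by
    intro p hp
    rw [← Finset.HasAntidiagonal.mem_antidiagonal.mp hp, add_smul, smul_mul_assoc, mul_smul_comm]
  rw [Finset.sum_congr rfl h, Finset.sum_add_distrib, Finset.Nat.sum_antidiagonal_succ,
    Finset.Nat.sum_antidiagonal_succ' (f := fun p => coeff p.1 f * (p.2 • coeff p.2 g))]
  simp only [coeff_tderiv, zero_smul, zero_mul, mul_zero, zero_add]

theorem tderiv_add {R : Type*} [Semiring R] (f g : PowerSeries R) :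
    tderiv (f + g) = tderiv f + tderiv g := by
  ext n
  simp [coeff_tderiv]

theorem tderiv_C {R : Type*} [Semiring R] (a : R) : tderiv (C a) = 0 := by
  ext n
  simp [coeff_tderiv]

theorem tderiv_X {R : Type*} [Semiring R] : tderiv (X : PowerSeries R) = 1 := by
  ext n
  rcases n with _ | n <;> simp [coeff_tderiv, coeff_X, coeff_one]

/-- Additive maps commuting with multiplication by the variable are determined by their values on
constant series. -/
theorem addMonoidHom_ext_of_X_mul {R S : Type*} [Ring R] [Ring S]
    (f g : PowerSeries R →+ PowerSeries S)
    (hf : ∀ q, f (X * q) = X * f q) (hg : ∀ q, g (X * q) = X * g q)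
    (h : ∀ a, f (C a) = g (C a)) : f = g := by
  have key : ∀ n q, coeff n (f q) = coeff n (g q) := by
    intro n
    induction n with
    | zero =>
      intro q
      rw [eq_X_mul_shift_add_const q]
      simp [hf, hg, h]
    | succ n ih =>
      intro q
      rw [eq_X_mul_shift_add_const q]
      simp only [map_add, hf, hg, h, coeff_succ_X_mul, ih]
  ext q n
  exact key n q

theorem exists_mul_eq_one {R : Type*} [Ring R] (f : PowerSeries R) (hf : coeff 0 f = 1) :
    ∃ g : PowerSeries R, f * g = 1 ∧ g * f = 1 :=
  ⟨invOfUnit f 1, mul_invOfUnit f 1 (by simpa using hf), invOfUnit_mul f 1 (by simpa using hf)⟩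

/-! ### Conjugation and commutator-closed subspaces. -/

section Lie

variable {k A : Type*} [Field k] [Ring A] [Algebra k A]

theorem coeff_commutator_mem (L : Submodule k A)
    (hL : ∀ x ∈ L, ∀ y ∈ L, x * y - y * x ∈ L) (f g : PowerSeries A)
    (hf : ∀ n, coeff n f ∈ L) (hg : ∀ n, coeff n g ∈ L) (n : ℕ) :
    coeff n (f * g - g * f) ∈ L := by
  rw [map_sub, coeff_mul, coeff_mul, ← Finset.Nat.sum_antidiagonal_swap, ← Finset.sum_sub_distrib]
  refine sum_mem fun p _ => ?_
  exact hL _ (hf p.2) _ (hg p.1)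

/-- If `a' = a e` and `a(0) = 1`, conjugation by `a` preserves every commutator-closed subspace containing the
coefficients of `e`. -/
theorem coeff_mem_of_conj [CharZero k] (L : Submodule k A)
    (hL : ∀ x ∈ L, ∀ y ∈ L, x * y - y * x ∈ L) (a e : PowerSeries A)
    (ha0 : coeff 0 a = 1) (ha : tderiv a = a * e) (he : ∀ n, coeff n e ∈ L)
    (n : ℕ) : ∀ x y : PowerSeries A, (∀ n, coeff n x ∈ L) → y * a = a * x → coeff n y ∈ L := by
  induction n with
  | zero =>
    intro x y hx hy
    have := congrArg (coeff 0) hy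
    simp only [coeff_zero_eq_constantCoeff, map_mul] at this ha0
    rw [ha0, mul_one, one_mul] at this
    have h0 := hx 0
    rwa [coeff_zero_eq_constantCoeff, ← this, ← coeff_zero_eq_constantCoeff_apply] at h0
  | succ n ih =>
    intro x y hx hy
    have h := congrArg tderiv hy
    rw [tderiv_mul, tderiv_mul, ha] at h
    -- Differentiating y a = a x shows that y' is the conjugate of x' + [e, x], whose coefficients
    -- again lie in L. The induction hypothesis thus applies to y', and coefficient n + 1 of y is
    -- recovered by dividing by n + 1.
    have h2 : tderiv y * a = a * (tderiv x + (e * x - x * e)) := by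
      have : y * (a * e) = a * x * e := by rw [← mul_assoc, hy]
      rw [this] at h
      rw [eq_sub_of_add_eq h]
      noncomm_ring
    have := ih _ _ (fun m => ?_) h2
    · rw [coeff_tderiv, ← Nat.cast_smul_eq_nsmul k] at this
      have h3 := L.smul_mem (((n + 1 : ℕ) : k)⁻¹) this
      rwa [smul_smul, inv_mul_cancel₀ (Nat.cast_ne_zero.mpr n.succ_ne_zero), one_smul] at h3
    · rw [map_add]
      refine add_mem ?_ (coeff_commutator_mem L hL e x he hx m)
      rw [coeff_tderiv]
      exact nsmul_mem (hx _) _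

/-- The two logarithmic derivatives of an invertible series have coefficients in the same
commutator-closed subspaces. -/
theorem coeff_mem_iff_of_tderiv [CharZero k] (L : Submodule k A)
    (hL : ∀ x ∈ L, ∀ y ∈ L, x * y - y * x ∈ L) (a e r : PowerSeries A)
    (ha0 : coeff 0 a = 1) (hae : tderiv a = a * e) (har : tderiv a = r * a) :
    (∀ n, coeff n e ∈ L) ↔ ∀ n, coeff n r ∈ L := by
  obtain ⟨b, hab, hba⟩ := exists_mul_eq_one a ha0
  constructor
  · intro he n
    exact coeff_mem_of_conj L hL a e ha0 hae he n e r he (by rw [← har, hae])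
  · intro hr n
    have hb0 : coeff 0 b = 1 := by
      have := congrArg (coeff 0) hab
      simpa [ha0, show constantCoeff a = 1 by simpa using ha0] using this
    -- The inverse series has the same shape, with -r in place of e: differentiate b a = 1. This
    -- gives the converse by the same lemma.
    have hb : tderiv b = b * (-r) := by
      have h := congrArg tderiv hba
      have h1 : tderiv (1 : PowerSeries A) = 0 := by simpa using tderiv_C (1 : A)
      rw [tderiv_mul, har, h1] at h
      have h2 := congrArg (· * b) h
      simp only [add_mul, mul_assoc, hab, mul_one, zero_mul] at h2
      rw [mul_neg]
      exact eq_neg_of_add_eq_zero_left h2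
    refine coeff_mem_of_conj L hL b (-r) hb0 hb (fun m => ?_) n r e hr ?_
    · rw [map_neg]; exact neg_mem (hr m)
    · calc e * b = b * (a * e) * b := by rw [← mul_assoc b, hba, one_mul]
        _ = b * r := by rw [← hae, har, mul_assoc, mul_assoc, hab, mul_one]

end Lie

end PowerSeries

namespace FormalInverse

/-! ### Operator series acting on power series. -/

section Action

open PowerSeries

variable {k P : Type*} [Field k] [CommRing P] [Algebra k P]

/-- Multiplication operators, coefficientwise. -/
noncomputable def mulOp (k : Type*) {P : Type*} [Field k] [CommRing P] [Algebra k P] :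
    PowerSeries P →+* PowerSeries (Module.End k P) :=
  PowerSeries.map (Algebra.lmul k P).toRingHom

theorem coeff_mulOp (p : PowerSeries P) (n : ℕ) :
    coeff n (mulOp k p) = LinearMap.mulLeft k (coeff n p) := by
  ext; simp [mulOp]

theorem mulOp_X : mulOp k (X : PowerSeries P) = X := by
  simp [mulOp]

/-- The action of a power series of operators on a power series. -/
noncomputable def act : PowerSeries (Module.End k P) →+ PowerSeries P →+ PowerSeries P :=
  AddMonoidHom.mk' (fun U => AddMonoidHom.mk'
    (fun p => mk fun N => ∑ ij ∈ Finset.HasAntidiagonal.antidiagonal N,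
      coeff ij.1 U (coeff ij.2 p))
    (fun p q => by ext n; simp [Finset.sum_add_distrib]))
    (fun U V => by ext p n; simp [Finset.sum_add_distrib])

theorem coeff_act (U : PowerSeries (Module.End k P)) (p : PowerSeries P) (N : ℕ) :
    coeff N (act U p) = ∑ ij ∈ Finset.HasAntidiagonal.antidiagonal N,
      coeff ij.1 U (coeff ij.2 p) := by
  simp [act]

theorem coeff_act_C (U : PowerSeries (Module.End k P)) (a : P) (N : ℕ) :
    coeff N (act U (C a)) = coeff N U a := by
  rw [coeff_act, Finset.sum_eq_single (N, 0)]
  · simp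
  · rintro ⟨i, j⟩ h hne
    have : j ≠ 0 := by
      rintro rfl
      exact hne (by simpa using h)
    simp [coeff_C, this]
  · simp

theorem coeff_mul_apply (U V : PowerSeries (Module.End k P)) (a : P) (N : ℕ) :
    coeff N (U * V) a = coeff N (act U (act V (C a))) := by
  rw [coeff_mul, coeff_act, LinearMap.sum_apply]
  simp [coeff_act_C]

theorem act_mul_C (U V : PowerSeries (Module.End k P)) (a : P) :
    act (U * V) (C a) = act U (act V (C a)) := by
  ext N
  rw [coeff_act_C, coeff_mul_apply]

theorem act_X_mul (U : PowerSeries (Module.End k P)) (q : PowerSeries P) :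
    act U (X * q) = X * act U q := by
  ext N
  rcases N with _ | N
  · simp [coeff_act]
  · rw [coeff_succ_X_mul, coeff_act, coeff_act, Finset.Nat.sum_antidiagonal_succ']
    simp [coeff_succ_X_mul]

theorem act_mul (U V : PowerSeries (Module.End k P)) (q : PowerSeries P) :
    act (U * V) q = act U (act V q) :=
  DFunLike.congr_fun (addMonoidHom_ext_of_X_mul (act (U * V)) ((act U).comp (act V))
    (fun q => act_X_mul _ q) (fun q => by simp [act_X_mul]) (fun a => act_mul_C U V a)) q

theorem act_one (q : PowerSeries P) : act (1 : PowerSeries (Module.End k P)) q = q :=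
  DFunLike.congr_fun (addMonoidHom_ext_of_X_mul (act 1) (AddMonoidHom.id _)
    (fun q => act_X_mul _ q) (fun q => by simp)
    (fun a => by ext n; rw [coeff_act_C]; by_cases h : n = 0 <;>
      simp [coeff_one, coeff_C, h])) q

theorem act_mulOp (p q : PowerSeries P) : act (mulOp k p) q = p * q := by
  ext N
  simp [coeff_act, coeff_mul, coeff_mulOp]

theorem ext_act {U V : PowerSeries (Module.End k P)}
    (h : ∀ a, act U (C a) = act V (C a)) : U = V := by
  ext N a
  rw [← coeff_act_C, h, coeff_act_C]

theorem tderiv_act_C (U : PowerSeries (Module.End k P)) (a : P) :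
    tderiv (act U (C a)) = act (tderiv U) (C a) := by
  ext N
  rw [coeff_tderiv, coeff_act_C, coeff_act_C, coeff_tderiv, LinearMap.smul_apply]

/-- Multiplicativity in p says U ∘ (mult. by p) = (mult. by U p) ∘ U. Both sides are additive in p
and commute with t, so constant p suffices; comparing operators on constants then reduces q as well.
-/
theorem act_mul_of_mul_C (U : PowerSeries (Module.End k P))
    (h : ∀ a b, act U (C (a * b)) = act U (C a) * act U (C b)) (p q : PowerSeries P) :
    act U (p * q) = act U p * act U q := by
  have hX : ∀ p, U * (X * p) = X * (U * p) := fun p => by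
    rw [← mul_assoc, (commute_X U).eq, mul_assoc]
  have key := addMonoidHom_ext_of_X_mul
    ((AddMonoidHom.mulLeft U).comp (mulOp k (P := P)).toAddMonoidHom)
    ((AddMonoidHom.mulRight U).comp ((mulOp k (P := P)).toAddMonoidHom.comp (act U)))
    (fun q => by simp [mulOp_X, hX])
    (fun q => by simp [mulOp_X, act_X_mul, mul_assoc])
    (fun a => ext_act fun b => by
      simp only [AddMonoidHom.comp_apply, AddMonoidHom.coe_mulLeft, AddMonoidHom.coe_mulRight,
        RingHom.toAddMonoidHom_eq_coe, AddMonoidHom.coe_coe, act_mul, act_mulOp, ← map_mul, h])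
  have := congrArg (fun W => act W q) (DFunLike.congr_fun key p)
  simpa [act_mul, act_mulOp] using this

/-- Same reduction to constants, applied to U ∘ (mult. by p) = (mult. by p) ∘ U + (mult. by U p). -/
theorem act_leibniz (U : PowerSeries (Module.End k P))
    (h : ∀ n, ∀ a b, coeff n U (a * b) = a * coeff n U b + coeff n U a * b)
    (p q : PowerSeries P) : act U (p * q) = p * act U q + act U p * q := by
  have hX : ∀ p, U * (X * p) = X * (U * p) := fun p => by
    rw [← mul_assoc, (commute_X U).eq, mul_assoc]
  have key := addMonoidHom_ext_of_X_mul
    ((AddMonoidHom.mulLeft U).comp (mulOp k (P := P)).toAddMonoidHom)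
    ((AddMonoidHom.mulRight U).comp (mulOp k (P := P)).toAddMonoidHom +
      (mulOp k (P := P)).toAddMonoidHom.comp (act U))
    (fun q => by simp [mulOp_X, hX])
    (fun q => by simp [mulOp_X, act_X_mul, mul_assoc, mul_add])
    (fun a => ext_act fun b => by
      ext n
      simp [act_mul, act_mulOp, ← map_mul, coeff_act_C, h, coeff_mul_C])
  have := congrArg (fun W => act W q) (DFunLike.congr_fun key p)
  simpa [act_mul, act_mulOp] using this

end Action

/-! ### Substitutions as operator series; the formal inverse. -/

section Substitution

open PowerSeries

variable {k : Type*} [Field k] {n : ℕ}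

/-- The substitution `xᵢ ↦ Hᵢ` as a power series of operators on polynomials. -/
noncomputable def substOp (H : Fin n → PowerSeries (MvPolynomial (Fin n) k)) :
    PowerSeries (Module.End k (MvPolynomial (Fin n) k)) :=
  mk fun m => ((coeff (R := MvPolynomial (Fin n) k) m).restrictScalars k).comp
    (MvPolynomial.aeval H).toLinearMap

theorem act_substOp_C (H : Fin n → PowerSeries (MvPolynomial (Fin n) k))
    (p : MvPolynomial (Fin n) k) : act (substOp H) (C p) = MvPolynomial.aeval H p := by
  ext1 m
  rw [coeff_act_C]
  simp [substOp]

theorem act_substOp (H : Fin n → PowerSeries (MvPolynomial (Fin n) k))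
    (p : PowerSeries (MvPolynomial (Fin n) k)) : act (substOp H) p = substX H p := by
  ext1 N
  rw [coeff_act, substX, coeff_mk, ← Finset.Nat.sum_antidiagonal_swap]
  simp [substOp]

theorem act_substOp_mul (H : Fin n → PowerSeries (MvPolynomial (Fin n) k))
    (p q : PowerSeries (MvPolynomial (Fin n) k)) :
    act (substOp H) (p * q) = act (substOp H) p * act (substOp H) q :=
  act_mul_of_mul_C _ (fun a b => by rw [act_substOp_C, act_substOp_C, act_substOp_C, map_mul]) p q

/-- Substitution is contravariant, hence the reversed order. Both sides are multiplicative, so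
agreement on the variables decides. -/
theorem substOp_mul (H K : Fin n → PowerSeries (MvPolynomial (Fin n) k)) :
    substOp H * substOp K = substOp (comp K H) := by
  refine ext_act fun p => ?_
  rw [act_mul, act_substOp_C, act_substOp_C]
  induction p using MvPolynomial.induction_on with
  | C a =>
    rw [MvPolynomial.aeval_C, MvPolynomial.aeval_C, PowerSeries.algebraMap_apply,
      act_substOp_C, MvPolynomial.algebraMap_eq, MvPolynomial.aeval_C,
      PowerSeries.algebraMap_apply, MvPolynomial.algebraMap_eq]
  | add p q hp hq => simp only [map_add, hp, hq]
  | mul_X p i hp =>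
    rw [map_mul, act_substOp_mul, hp, map_mul, MvPolynomial.aeval_X, MvPolynomial.aeval_X,
      act_substOp, comp]

theorem substOp_idTuple : substOp (idTuple k n) = 1 := by
  refine ext_act fun p => ?_
  rw [act_substOp_C, act_one]
  induction p using MvPolynomial.induction_on with
  | C a =>
    rw [MvPolynomial.aeval_C, PowerSeries.algebraMap_apply, MvPolynomial.algebraMap_eq]
  | add p q hp hq => simp only [map_add, hp, hq]
  | mul_X p i hp => rw [map_mul, map_mul, hp, MvPolynomial.aeval_X, idTuple]

theorem substOp_injective :
    Function.Injective (substOp : (Fin n → PowerSeries (MvPolynomial (Fin n) k)) → _) := by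
  intro H K h
  funext i
  have := congrArg (fun U => act U (C (MvPolynomial.X i))) h
  simpa only [act_substOp_C, MvPolynomial.aeval_X] using this

theorem isFormalInverse_iff (F : Fin n → MvPolynomial (Fin n) k)
    (G : Fin n → PowerSeries (MvPolynomial (Fin n) k)) :
    IsFormalInverse F G ↔
      substOp G * substOp (xAddT F) = 1 ∧ substOp (xAddT F) * substOp G = 1 := by
  rw [IsFormalInverse, substOp_mul, substOp_mul, ← substOp_idTuple (k := k) (n := n),
    substOp_injective.eq_iff, substOp_injective.eq_iff]

theorem coeff_zero_substOp_xAddT (F : Fin n → MvPolynomial (Fin n) k) :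
    coeff 0 (substOp (xAddT F)) = 1 := by
  refine LinearMap.ext fun p => ?_
  rw [← coeff_act_C, act_substOp_C, Module.End.one_apply]
  induction p using MvPolynomial.induction_on with
  | C a =>
    rw [MvPolynomial.aeval_C, PowerSeries.algebraMap_apply, MvPolynomial.algebraMap_eq]
    simp
  | add p q hp hq => simp only [map_add, hp, hq]
  | mul_X p i hp =>
    rw [map_mul, MvPolynomial.aeval_X, xAddT, coeff_zero_eq_constantCoeff_apply, map_mul,
      ← coeff_zero_eq_constantCoeff_apply, hp]
    simp

theorem existsUnique_isFormalInverse (F : Fin n → MvPolynomial (Fin n) k) :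
    ∃! G : Fin n → PowerSeries (MvPolynomial (Fin n) k), IsFormalInverse F G := by
  obtain ⟨b, hab, hba⟩ := exists_mul_eq_one _ (coeff_zero_substOp_xAddT F)
  refine ⟨fun i => act b (C (MvPolynomial.X i)), ?_, fun G hG => ?_⟩
  · set G : Fin n → PowerSeries (MvPolynomial (Fin n) k) := fun i => act b (C (MvPolynomial.X i))
    -- The inverse b is not known in advance to be a substitution. Its values on the variables
    -- define G, and uniqueness of inverses then forces `substOp G = b`.
    have h1 : substOp (xAddT F) * substOp G = 1 := by
      rw [substOp_mul, ← substOp_idTuple]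
      congr 1
      funext i
      rw [comp, ← act_substOp, ← act_mul, hab, act_one, idTuple]
    have h2 : substOp G = b := by
      rw [← one_mul (substOp G), ← hba, mul_assoc, h1, mul_one]
    exact (isFormalInverse_iff F G).mpr ⟨by rw [h2, hba], h1⟩
  · have h1 := ((isFormalInverse_iff F G).mp hG).2
    have h2 : substOp G = b := by
      rw [← one_mul (substOp G), ← hba, mul_assoc, h1, mul_one]
    funext i
    rw [← h2, act_substOp_C, MvPolynomial.aeval_X]

theorem act_substOp_inverse {F : Fin n → MvPolynomial (Fin n) k}
    {G : Fin n → PowerSeries (MvPolynomial (Fin n) k)} (hG : IsFormalInverse F G) (i : Fin n) :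
    act (substOp (xAddT F)) (G i) = C (MvPolynomial.X i) := by
  rw [act_substOp]
  exact congrFun hG.2 i

theorem coeffTuple_zero {F : Fin n → MvPolynomial (Fin n) k}
    {G : Fin n → PowerSeries (MvPolynomial (Fin n) k)} (hG : IsFormalInverse F G) :
    coeffTuple G 0 = MvPolynomial.X := by
  funext i
  have := congrArg (coeff 0) (act_substOp_inverse hG i)
  rw [coeff_act] at this
  rw [coeffTuple]
  simpa only [Finset.Nat.antidiagonal_zero, Finset.sum_singleton, coeff_zero_substOp_xAddT,
    Module.End.one_apply, coeff_zero_C] using this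

end Substitution

end FormalInverse

namespace FormalInverse

/-! ### The two logarithmic derivatives of the substitution X + tF. -/

section LogarithmicDerivatives

open PowerSeries

variable {k : Type*} [Field k] {n : ℕ}

/-- Derivations along the homomorphism `aeval H` kill constants and are determined on the variables.
Both forms of the logarithmic derivative are checked this way. -/
theorem ext_of_substOp_leibniz (H : Fin n → PowerSeries (MvPolynomial (Fin n) k))
    (U V : PowerSeries (Module.End k (MvPolynomial (Fin n) k)))
    (hU : ∀ a b, act U (C (a * b)) =
      MvPolynomial.aeval H a * act U (C b) + act U (C a) * MvPolynomial.aeval H b)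
    (hV : ∀ a b, act V (C (a * b)) =
      MvPolynomial.aeval H a * act V (C b) + act V (C a) * MvPolynomial.aeval H b)
    (h : ∀ i, act U (C (MvPolynomial.X i)) = act V (C (MvPolynomial.X i))) : U = V := by
  have hconst : ∀ W : PowerSeries (Module.End k (MvPolynomial (Fin n) k)),
      (∀ a b, act W (C (a * b)) =
        MvPolynomial.aeval H a * act W (C b) + act W (C a) * MvPolynomial.aeval H b) →
      ∀ c : k, act W (C (MvPolynomial.C c)) = 0 := by
    intro W hW c
    have h1 : act W (C 1) = 0 := by simpa only [mul_one, map_one, one_mul, left_eq_add] using hW 1 1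
    ext1 m
    have h2 := congrArg (coeff m) h1
    rw [coeff_act_C, map_zero] at h2
    rw [coeff_act_C, map_zero, ← mul_one (MvPolynomial.C c), ← MvPolynomial.smul_eq_C_mul,
      map_smul, h2, smul_zero]
  refine ext_act fun p => ?_
  induction p using MvPolynomial.induction_on with
  | C a => rw [hconst U hU, hconst V hV]
  | add p q hp hq => simp only [map_add, hp, hq]
  | mul_X p i hp => rw [hU, hV, hp, h]

theorem tderiv_substOp_leibniz (H : Fin n → PowerSeries (MvPolynomial (Fin n) k))
    (a b : MvPolynomial (Fin n) k) : act (tderiv (substOp H)) (C (a * b)) =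
      MvPolynomial.aeval H a * act (tderiv (substOp H)) (C b) +
        act (tderiv (substOp H)) (C a) * MvPolynomial.aeval H b := by
  simp only [← tderiv_act_C]
  rw [act_substOp_C, act_substOp_C, act_substOp_C, map_mul, tderiv_mul, add_comm]

/-- A sequence of derivations as a power series of operators. -/
noncomputable def derSeries
    (d : ℕ → Derivation k (MvPolynomial (Fin n) k) (MvPolynomial (Fin n) k)) :
    PowerSeries (Module.End k (MvPolynomial (Fin n) k)) :=
  mk fun j => (d j : Module.End k (MvPolynomial (Fin n) k))

theorem coeff_derSeries
    (d : ℕ → Derivation k (MvPolynomial (Fin n) k) (MvPolynomial (Fin n) k)) (j : ℕ) :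
    coeff j (derSeries d) = (d j : Module.End k (MvPolynomial (Fin n) k)) := by
  simp [derSeries]

theorem coeff_derSeries_apply
    (d : ℕ → Derivation k (MvPolynomial (Fin n) k) (MvPolynomial (Fin n) k)) (j : ℕ)
    (p : MvPolynomial (Fin n) k) : coeff j (derSeries d) p = d j p := by
  rw [coeff_derSeries]; rfl

theorem act_derSeries_mul
    (d : ℕ → Derivation k (MvPolynomial (Fin n) k) (MvPolynomial (Fin n) k))
    (p q : PowerSeries (MvPolynomial (Fin n) k)) :
    act (derSeries d) (p * q) = p * act (derSeries d) q + act (derSeries d) p * q :=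
  act_leibniz _ (fun m a b => by
    simp only [coeff_derSeries_apply, Derivation.leibniz, smul_eq_mul, mul_comm b]) p q

theorem tderiv_substOp_eq_mul
    (H : Fin n → PowerSeries (MvPolynomial (Fin n) k))
    (d : ℕ → Derivation k (MvPolynomial (Fin n) k) (MvPolynomial (Fin n) k))
    (h : ∀ i, tderiv (H i) = act (substOp H) (act (derSeries d) (C (MvPolynomial.X i)))) :
    tderiv (substOp H) = substOp H * derSeries d := by
  refine ext_of_substOp_leibniz H _ _ (tderiv_substOp_leibniz H) (fun a b => ?_) (fun i => ?_)
  · rw [act_mul, map_mul, act_derSeries_mul, map_add, act_substOp_mul, act_substOp_mul,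
      act_substOp_C, act_substOp_C, act_mul, act_mul]
  · rw [← tderiv_act_C, act_substOp_C, MvPolynomial.aeval_X, h, act_mul]

theorem tderiv_substOp_eq_mul'
    (H : Fin n → PowerSeries (MvPolynomial (Fin n) k))
    (d : ℕ → Derivation k (MvPolynomial (Fin n) k) (MvPolynomial (Fin n) k))
    (h : ∀ i, tderiv (H i) = act (derSeries d) (H i)) :
    tderiv (substOp H) = derSeries d * substOp H := by
  refine ext_of_substOp_leibniz H _ _ (tderiv_substOp_leibniz H) (fun a b => ?_) (fun i => ?_)
  · rw [act_mul, map_mul, act_substOp_mul, act_derSeries_mul, act_mul, act_mul,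
      act_substOp_C, act_substOp_C]
  · rw [← tderiv_act_C, act_substOp_C, MvPolynomial.aeval_X, h, act_mul, act_substOp_C,
      MvPolynomial.aeval_X]

theorem tderiv_xAddT (F : Fin n → MvPolynomial (Fin n) k) (i : Fin n) :
    tderiv (xAddT F i) = C (F i) := by
  rw [xAddT, tderiv_add, tderiv_mul, tderiv_C, tderiv_C, tderiv_X]
  simp

theorem derivationOf_X (F : Fin n → MvPolynomial (Fin n) k) (i : Fin n) :
    derivationOf F (MvPolynomial.X i) = F i :=
  MvPolynomial.mkDerivation_X _ _ _

theorem rightPower_succ_succ_X (F : Fin n → MvPolynomial (Fin n) k) (m : ℕ) (i : Fin n) :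
    rightPower (derivationOf F) (m + 2) (MvPolynomial.X i) =
      rightPower (derivationOf F) (m + 1) (F i) := by
  rw [rightPower, lsMul, derivationOf_X, derivationOf_X]

/-- On variables the claim is F_i = r(x_i + tF_i), that is r_0(x_i) = F_i and r_{m+1}(x_i) =
-r_m(F_i). This is the recursion of right powers up to alternating signs. -/
theorem tderiv_substOp_xAddT_eq_rightPower (F : Fin n → MvPolynomial (Fin n) k) :
    tderiv (substOp (xAddT F)) =
      derSeries (fun j => (-1 : k) ^ j • rightPower (derivationOf F) (j + 1)) *
        substOp (xAddT F) := by
  refine tderiv_substOp_eq_mul' _ _ fun i => ?_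
  rw [tderiv_xAddT, xAddT, map_add, act_X_mul]
  ext1 m
  rcases m with _ | m
  · rw [map_add, coeff_act_C, coeff_derSeries_apply, coeff_zero_X_mul, coeff_zero_C, pow_zero,
      one_smul, rightPower, derivationOf_X, add_zero]
  · rw [map_add, coeff_act_C, coeff_derSeries_apply, coeff_succ_X_mul, coeff_act_C,
      coeff_derSeries_apply, Derivation.smul_apply, Derivation.smul_apply, rightPower_succ_succ_X,
      coeff_succ_C, pow_succ, mul_neg_one, neg_smul, neg_add_cancel]

theorem tderiv_substOp_xAddT_eq_coeffTuple {F : Fin n → MvPolynomial (Fin n) k}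
    {G : Fin n → PowerSeries (MvPolynomial (Fin n) k)} (hG : IsFormalInverse F G) :
    tderiv (substOp (xAddT F)) =
      substOp (xAddT F) * derSeries (fun j => -derivationOf (coeffTuple G (j + 1))) := by
  refine tderiv_substOp_eq_mul _ _ fun i => ?_
  set Q := act (derSeries fun j => -derivationOf (coeffTuple G (j + 1))) (C (MvPolynomial.X i))
    with hQ
  -- The index shift j + 1 is division by t. Applying S to x_i - G_i gives (x_i + tF_i) - x_i =
  -- tF_i, and cancelling t leaves S(Q) = F_i.
  have h1 : X * Q = C (MvPolynomial.X i) - G i := by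
    ext1 m
    rcases m with _ | m
    · have h0 : coeff 0 (G i) = MvPolynomial.X i := congrFun (coeffTuple_zero hG) i
      rw [coeff_zero_X_mul, map_sub, coeff_zero_C, h0, sub_self]
    · rw [coeff_succ_X_mul, hQ, coeff_act_C, coeff_derSeries_apply, Derivation.neg_apply,
        derivationOf_X, map_sub, coeff_succ_C, zero_sub, coeffTuple]
  have h2 : X * act (substOp (xAddT F)) Q = X * C (F i) := by
    rw [← act_X_mul, h1, map_sub, act_substOp_inverse hG, act_substOp_C, MvPolynomial.aeval_X,
      xAddT, add_sub_cancel_left]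
  rw [tderiv_xAddT]
  ext1 m
  rw [← coeff_succ_X_mul, ← h2, coeff_succ_X_mul]

theorem forall_mem_iff_of_isFormalInverse [CharZero k] {F : Fin n → MvPolynomial (Fin n) k}
    {G : Fin n → PowerSeries (MvPolynomial (Fin n) k)} (hG : IsFormalInverse F G)
    (L : LieSubalgebra k (Derivation k (MvPolynomial (Fin n) k) (MvPolynomial (Fin n) k))) :
    (∀ j, derivationOf (coeffTuple G (j + 1)) ∈ L) ↔
      ∀ j, rightPower (derivationOf F) (j + 1) ∈ L := by
  -- The Lie subalgebra is moved into the associative algebra of operators, where its bracket is the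
  -- commutator.
  let φ : Derivation k (MvPolynomial (Fin n) k) (MvPolynomial (Fin n) k) →ₗ[k]
      Module.End k (MvPolynomial (Fin n) k) :=
    { toFun := fun D => D, map_add' := fun _ _ => rfl, map_smul' := fun _ _ => rfl }
  have hφ : ∀ D, D ∈ L ↔ (D : Module.End k (MvPolynomial (Fin n) k)) ∈ L.toSubmodule.map φ := by
    refine fun D => ⟨fun h => ⟨D, h, rfl⟩, ?_⟩
    rintro ⟨D', h, h'⟩
    have : D' = D := Derivation.ext fun p => LinearMap.congr_fun h' p
    rwa [← this]
  have key := coeff_mem_iff_of_tderiv (L.toSubmodule.map φ) ?_ _ _ _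
    (coeff_zero_substOp_xAddT F) (tderiv_substOp_xAddT_eq_coeffTuple hG)
    (tderiv_substOp_xAddT_eq_rightPower F)
  · simp only [coeff_derSeries, ← hφ, neg_mem_iff] at key
    rw [key]
    refine forall_congr' fun j => ⟨fun h => ?_, fun h => L.smul_mem _ h⟩
    have := L.smul_mem ((-1 : k) ^ j) h
    rwa [smul_smul, ← mul_pow, neg_one_mul, neg_neg, one_pow, one_smul] at this
  · rintro _ ⟨D, hD, rfl⟩ _ ⟨D', hD', rfl⟩
    exact ⟨⁅D, D'⁆, L.lie_mem hD hD', rfl⟩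

end LogarithmicDerivatives

end FormalInverse

theorem theorem2 {k : Type*} [Field k] [CharZero k] (n : ℕ)
    (F : Fin n → MvPolynomial (Fin n) k) :
    (∃! G : Fin n → PowerSeries (MvPolynomial (Fin n) k), FormalInverse.IsFormalInverse F G) ∧
    ∀ G : Fin n → PowerSeries (MvPolynomial (Fin n) k), FormalInverse.IsFormalInverse F G →
      FormalInverse.coeffTuple G 0 = MvPolynomial.X ∧
      FormalInverse.rightPowerLieAlgebra (FormalInverse.derivationOf F) =
        LieSubalgebra.lieSpan k
          (Derivation k (MvPolynomial (Fin n) k) (MvPolynomial (Fin n) k))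
          {E | ∃ m : ℕ, 1 ≤ m ∧
            E = FormalInverse.derivationOf (FormalInverse.coeffTuple G m)} := by
  refine ⟨FormalInverse.existsUnique_isFormalInverse F, fun G hG =>
    ⟨FormalInverse.coeffTuple_zero hG, le_antisymm ?_ ?_⟩⟩
  · refine LieSubalgebra.lieSpan_le.mpr ?_
    rintro _ ⟨m, hm, rfl⟩
    obtain ⟨j, rfl⟩ := Nat.exists_eq_add_of_le' hm
    refine (FormalInverse.forall_mem_iff_of_isFormalInverse hG _).mp (fun i => ?_) j
    exact LieSubalgebra.subset_lieSpan ⟨i + 1, Nat.succ_pos i, rfl⟩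
  · refine LieSubalgebra.lieSpan_le.mpr ?_
    rintro _ ⟨m, hm, rfl⟩
    obtain ⟨j, rfl⟩ := Nat.exists_eq_add_of_le' hm
    refine (FormalInverse.forall_mem_iff_of_isFormalInverse hG _).mpr (fun i => ?_) j
    exact LieSubalgebra.subset_lieSpan ⟨i + 1, Nat.succ_pos i, rfl⟩
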